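/- Let $n\ge 1$ be an integer and let $K$ and $K'$ be compact Hausdorff spaces. For a compact Hausdorff space $S$, let $C(S)$ be the algebra of continuous complex-valued functions on $S$ with the supremum norm. Let $C^n([0,1],C(S))$ be the algebra of all $n$ times continuously differentiable functions $f:[0,1]\to C(S)$ (one-sided derivatives at the endpoints), with the norm $\|f\|=\sum_{i=0}^n \frac{\|f^{(i)}\|_\infty}{i!}$, and let $\mathrm{Lip}^n([0,1],C(S))$ be the algebra of those $f\in C^n([0,1],C(S))$ for which $f,f',\dots,f^{(n)}$ are all Lipschitz, with the norm $\|f\|=\sum_{i=0}^n\frac{\|f^{(i)}\|_{\infty}+L(f^{(i)})}{i!}$, where $L(g)=\sup_{x\ne y}\frac{\|g(x)-g(y)\|}{|x-y|}$. Let $\mathcal A$ be either $C^n([0,1],C(K))$ or $\mathrm{Lip}^n([0,1],C(K))$, let $\mathcal B$ be either $C^n([0,1],C(K'))$ or $\mathrm{Lip}^n([0,1],C(K'))$, and let $T:\mathcal A\to\mathcal B$ be a unital ring homomorphism (additive and multiplicative, not assumed to be homogeneous for real or complex scalars) that is continuous for these norms. Then there are a continuous function $\tau:K'\to K$, a family $\{\psi_s\}_{s\in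 K'}$ of continuous functions $\psi_s:[0,1]\to[0,1]$, and a clopen subset $\mathcal C$ of $K'$ such that for all $f\in\mathcal A$ and $y\in[0,1]$ $$T(f)(y)(s)=\begin{cases} f(\psi_s(y))(\tau(s)), & s\in\mathcal C,\\[2pt] \overline{f(\psi_s(y))(\tau(s))}, & s\in K'\setminus\mathcal C.\end{cases}$$ -/

import Mathlib

open Set unitInterval

noncomputable section

section Norms

variable {E : Type*} [NormedCommRing E]

/-- The supremum norm `‖g‖_∞ = sup_x ‖g x‖`. -/
def supNorm (g : I → E) : ℝ := ⨆ x : I, ‖g x‖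

/-- The Lipschitz number `L(g) = sup_{x ≠ y} ‖g x - g y‖ / |x - y|` (the pairs with `x = y`
contribute the value `0`). -/
def lipNumber (g : I → E) : ℝ := ⨆ p : I × I, ‖g p.1 - g p.2‖ / dist p.1 p.2

/-- `g : [0,1] → E` is a Lipschitz function. -/
def IsLip (g : I → E) : Prop := ∃ C : NNReal, LipschitzWith C g

lemma bddAbove_norm {g : I → E} (hg : Continuous g) : BddAbove (range fun x => ‖g x‖) :=
  (isCompact_range hg.norm).bddAbove

lemma supNorm_nonneg (g : I → E) : 0 ≤ supNorm g := Real.iSup_nonneg fun _ => norm_nonneg _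

lemma supNorm_zero : supNorm (0 : I → E) = 0 := by simp [supNorm]

lemma supNorm_neg (g : I → E) : supNorm (-g) = supNorm g := by simp [supNorm]

lemma supNorm_add_le {g h : I → E} (hg : Continuous g) (hh : Continuous h) :
    supNorm (g + h) ≤ supNorm g + supNorm h :=
  ciSup_le fun x => (norm_add_le _ _).trans
    (add_le_add (le_ciSup (bddAbove_norm hg) x) (le_ciSup (bddAbove_norm hh) x))

lemma eq_zero_of_supNorm {g : I → E} (hg : Continuous g) (h : supNorm g = 0) (x : I) :
    g x = 0 :=
  norm_le_zero_iff.1 (h ▸ le_ciSup (bddAbove_norm hg) x)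

lemma IsLip.continuous {g : I → E} (hg : IsLip g) : Continuous g :=
  hg.elim fun _ h => LipschitzWith.continuous h

lemma isLip_const (e : E) : IsLip (fun _ : I => e) := ⟨0, LipschitzWith.const e⟩

lemma IsLip.add {g h : I → E} (hg : IsLip g) (hh : IsLip h) : IsLip (g + h) := by
  obtain ⟨a, ha⟩ := hg
  obtain ⟨b, hb⟩ := hh
  exact ⟨a + b, LipschitzWith.add ha hb⟩

lemma IsLip.neg {g : I → E} (hg : IsLip g) : IsLip (-g) := by
  obtain ⟨a, ha⟩ := hg
  exact ⟨a, LipschitzWith.neg ha⟩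

lemma IsLip.sum {ι : Type*} (s : Finset ι) {g : ι → I → E} (hg : ∀ i ∈ s, IsLip (g i)) :
    IsLip (∑ i ∈ s, g i) :=
  Finset.sum_induction g IsLip (fun _ _ => IsLip.add) (isLip_const 0) hg

lemma IsLip.mul {g h : I → E} (hg : IsLip g) (hh : IsLip h) : IsLip (fun x => g x * h x) := by
  obtain ⟨A, hA⟩ := bddAbove_norm hg.continuous
  obtain ⟨B, hB⟩ := bddAbove_norm hh.continuous
  obtain ⟨a, ha⟩ := hg
  obtain ⟨b, hb⟩ := hh
  have hA' : ∀ x, ‖g x‖ ≤ A := fun x => hA ⟨x, rfl⟩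
  have hB' : ∀ x, ‖h x‖ ≤ B := fun x => hB ⟨x, rfl⟩
  have hA0 : 0 ≤ A := (norm_nonneg _).trans (hA' 0)
  have hB0 : 0 ≤ B := (norm_nonneg _).trans (hB' 0)
  refine ⟨⟨A * b + a * B, by positivity⟩, LipschitzWith.of_dist_le_mul fun x y => ?_⟩
  have e : g x * h x - g y * h y = g x * (h x - h y) + (g x - g y) * h y := by ring
  have h1 : ‖g x - g y‖ ≤ a * dist x y := by simpa [dist_eq_norm] using ha.dist_le_mul x y
  have h2 : ‖h x - h y‖ ≤ b * dist x y := by simpa [dist_eq_norm] using hb.dist_le_mul x y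
  rw [dist_eq_norm (g x * h x), e]
  calc _ ≤ ‖g x‖ * ‖h x - h y‖ + ‖g x - g y‖ * ‖h y‖ :=
        (norm_add_le _ _).trans (add_le_add (norm_mul_le _ _) (norm_mul_le _ _))
    _ ≤ A * (b * dist x y) + (a * dist x y) * B := by
        gcongr
        · exact hA' x
        · exact hB' y
    _ = (A * b + a * B) * dist x y := by ring

lemma bddAbove_lip {g : I → E} (hg : IsLip g) :
    BddAbove (range fun p : I × I => ‖g p.1 - g p.2‖ / dist p.1 p.2) := by
  obtain ⟨a, ha⟩ := hg
  refine ⟨a, ?_⟩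
  rintro _ ⟨p, rfl⟩
  exact div_le_of_le_mul₀ dist_nonneg a.2 (by simpa [dist_eq_norm] using ha.dist_le_mul p.1 p.2)

lemma lipNumber_nonneg (g : I → E) : 0 ≤ lipNumber g := Real.iSup_nonneg fun _ => by positivity

lemma lipNumber_zero : lipNumber (0 : I → E) = 0 := by simp [lipNumber]

lemma lipNumber_neg (g : I → E) : lipNumber (-g) = lipNumber g := by
  unfold lipNumber
  congr 1
  funext p
  rw [Pi.neg_apply, Pi.neg_apply, neg_sub_neg, norm_sub_rev]

lemma lipNumber_add_le {g h : I → E} (hg : IsLip g) (hh : IsLip h) :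
    lipNumber (g + h) ≤ lipNumber g + lipNumber h :=
  ciSup_le fun p => by
    refine le_trans ?_ (add_le_add (le_ciSup (bddAbove_lip hg) p) (le_ciSup (bddAbove_lip hh) p))
    rw [← add_div]
    gcongr
    rw [Pi.add_apply, Pi.add_apply, add_sub_add_comm]
    exact norm_add_le _ _

end Norms

section Derivatives

variable {E : Type*} [NormedCommRing E] [NormedAlgebra ℝ E]

/-- `f : [0,1] → E` is `n` times continuously differentiable on `[0,1]` (one-sided derivatives at
the endpoints). The extension of `f` to `ℝ` only serves to apply Mathlib's calculus within `[0,1]`;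
no value outside `[0,1]` is used. -/
def IsCn (n : ℕ) (f : C(I, E)) : Prop :=
  ContDiffOn ℝ n (IccExtend zero_le_one f) (Icc (0 : ℝ) 1)

/-- The `i`-th derivative `f⁽ⁱ⁾ : [0,1] → E`. -/
def derivI (i : ℕ) (f : C(I, E)) : I → E := fun x =>
  iteratedDerivWithin i (IccExtend zero_le_one f) (Icc (0 : ℝ) 1) x

lemma IsCn.of_le {n m : ℕ} {f : C(I, E)} (hf : IsCn n f) (h : m ≤ n) : IsCn m f :=
  ContDiffOn.of_le hf (by exact_mod_cast h)

lemma isCn_const (n : ℕ) (e : E) : IsCn n (ContinuousMap.const I e) :=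
  contDiffOn_const (c := e)

lemma IsCn.add {n : ℕ} {f g : C(I, E)} (hf : IsCn n f) (hg : IsCn n g) : IsCn n (f + g) :=
  ContDiffOn.add hf hg

lemma IsCn.mul {n : ℕ} {f g : C(I, E)} (hf : IsCn n f) (hg : IsCn n g) : IsCn n (f * g) :=
  ContDiffOn.mul hf hg

lemma IsCn.neg {n : ℕ} {f : C(I, E)} (hf : IsCn n f) : IsCn n (-f) :=
  ContDiffOn.neg hf

lemma derivI_zero_apply (f : C(I, E)) (x : I) : derivI 0 f x = f x := by
  simp [derivI, IccExtend_val]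

lemma derivI_const (i : ℕ) (e : E) :
    derivI i (ContinuousMap.const I e) = fun _ => if i = 0 then e else 0 := by
  funext x
  exact iteratedDerivWithin_const (n := i) (c := e)

lemma derivI_add {i : ℕ} {f g : C(I, E)} (hf : IsCn i f) (hg : IsCn i g) :
    derivI i (f + g) = derivI i f + derivI i g := by
  funext x
  exact iteratedDerivWithin_add x.2 uniqueDiffOn_Icc_zero_one (hf x x.2) (hg x x.2)

lemma derivI_neg (i : ℕ) (f : C(I, E)) : derivI i (-f) = -derivI i f := by
  funext x
  exact iteratedDerivWithin_neg (IccExtend zero_le_one f)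

lemma derivI_mul {i : ℕ} {f g : C(I, E)} (hf : IsCn i f) (hg : IsCn i g) :
    derivI i (f * g) = ∑ j ∈ Finset.range (i + 1),
      fun x => (i.choose j : E) * derivI j f x * derivI (i - j) g x := by
  funext x
  rw [Finset.sum_apply]
  exact iteratedDerivWithin_mul x.2 uniqueDiffOn_Icc_zero_one (hf x x.2) (hg x x.2)

lemma continuous_derivI {i : ℕ} {f : C(I, E)} (hf : IsCn i f) : Continuous (derivI i f) :=
  (ContDiffOn.continuousOn_iteratedDerivWithin hf le_rfl uniqueDiffOn_Icc_zero_one).domRestrict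

end Derivatives

section Algebras

variable (n : ℕ) (E : Type*) [NormedCommRing E] [NormedAlgebra ℝ E]

/-- The `n` times continuously differentiable functions, as a subring of `C([0,1],E)`. -/
def cnSubring : Subring C(I, E) where
  carrier := {f | IsCn n f}
  zero_mem' := isCn_const n 0
  one_mem' := isCn_const n 1
  add_mem' hf hg := IsCn.add hf hg
  mul_mem' hf hg := IsCn.mul hf hg
  neg_mem' hf := IsCn.neg hf

/-- The functions in `C^n([0,1],E)` for which `f, f', …, f⁽ⁿ⁾` are all Lipschitz, as a subring of
`C([0,1],E)`. -/
def lipnSubring : Subring C(I, E) where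
  carrier := {f | IsCn n f ∧ ∀ i ≤ n, IsLip (derivI i f)}
  zero_mem' := ⟨isCn_const n 0, fun i _ => by
    have h := derivI_const i (0 : E)
    exact (h ▸ isLip_const _ : IsLip (derivI i (ContinuousMap.const I (0 : E))))⟩
  one_mem' := ⟨isCn_const n 1, fun i _ => by
    have h := derivI_const i (1 : E)
    exact (h ▸ isLip_const _ : IsLip (derivI i (ContinuousMap.const I (1 : E))))⟩
  add_mem' hf hg := ⟨hf.1.add hg.1, fun i hi => by
    rw [derivI_add (hf.1.of_le hi) (hg.1.of_le hi)]
    exact (hf.2 i hi).add (hg.2 i hi)⟩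
  mul_mem' hf hg := ⟨hf.1.mul hg.1, fun i hi => by
    rw [derivI_mul (hf.1.of_le hi) (hg.1.of_le hi)]
    refine IsLip.sum _ fun j hj => ?_
    have hj' : j ≤ i := Nat.lt_succ_iff.1 (Finset.mem_range.1 hj)
    exact ((isLip_const _).mul (hf.2 j (hj'.trans hi))).mul
      (hg.2 (i - j) ((Nat.sub_le _ _).trans hi))⟩
  neg_mem' hf := ⟨hf.1.neg, fun i hi => by
    rw [derivI_neg]
    exact (hf.2 i hi).neg⟩

/-- The algebra `C^n([0,1],E)`. This is a type of its own, so that it carries the `C^n` norm below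
and not the supremum norm of `C([0,1],E)`. -/
def CnAlg : Type _ := cnSubring n E

/-- The algebra `Lip^n([0,1],E)`, likewise with its own norm below. -/
def LipnAlg : Type _ := lipnSubring n E

variable {n E}

namespace CnAlg

instance : CommRing (CnAlg n E) := inferInstanceAs (CommRing (cnSubring n E))

/-- The underlying continuous function. -/
def toC (f : CnAlg n E) : C(I, E) := Subtype.val f

instance : FunLike (CnAlg n E) I E where
  coe f := f.toC
  coe_injective _ _ h := Subtype.ext (DFunLike.coe_injective h)

lemma isCn (f : CnAlg n E) : IsCn n f.toC := Subtype.property f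

/-- `‖f‖ = ∑_{i=0}^n ‖f⁽ⁱ⁾‖_∞ / i!`. -/
def cnNorm (f : CnAlg n E) : ℝ :=
  ∑ i ∈ Finset.range (n + 1), supNorm (derivI i f.toC) / (i.factorial : ℝ)

/-- `C^n([0,1],E)` with its norm; addition is that of the ring structure. -/
instance : NormedAddCommGroup (CnAlg n E) :=
  AddGroupNorm.toNormedAddCommGroup
    { toFun := cnNorm
      map_zero' := Finset.sum_eq_zero fun i _ => by
        have h : derivI i (0 : CnAlg n E).toC = 0 :=
          (derivI_const i (0 : E)).trans (by funext; simp)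
        rw [h, supNorm_zero, zero_div]
      add_le' := fun f g => by
        unfold cnNorm
        rw [← Finset.sum_add_distrib]
        refine Finset.sum_le_sum fun i hi => ?_
        have hi' : i ≤ n := Nat.lt_succ_iff.1 (Finset.mem_range.1 hi)
        have hf := f.isCn.of_le hi'
        have hg := g.isCn.of_le hi'
        have h : derivI i (f + g).toC = derivI i f.toC + derivI i g.toC := derivI_add hf hg
        rw [h, ← add_div]
        gcongr
        exact supNorm_add_le (continuous_derivI hf) (continuous_derivI hg)
      neg' := fun f => Finset.sum_congr rfl fun i _ => by
        have h : derivI i (-f).toC = -derivI i f.toC := derivI_neg i f.toC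
        rw [h, supNorm_neg]
      eq_zero_of_map_eq_zero' := fun f hf => by
        have h := (Finset.sum_eq_zero_iff_of_nonneg fun i _ =>
          div_nonneg (supNorm_nonneg _) (Nat.cast_nonneg _)).1 hf 0 (by simp)
        simp only [Nat.factorial_zero, Nat.cast_one, div_one] at h
        refine Subtype.ext (ContinuousMap.ext fun x => ?_)
        rw [← derivI_zero_apply]
        exact eq_zero_of_supNorm (continuous_derivI (f.isCn.of_le (Nat.zero_le n))) h x }

end CnAlg

namespace LipnAlg

instance : CommRing (LipnAlg n E) := inferInstanceAs (CommRing (lipnSubring n E))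

/-- The underlying continuous function. -/
def toC (f : LipnAlg n E) : C(I, E) := Subtype.val f

instance : FunLike (LipnAlg n E) I E where
  coe f := f.toC
  coe_injective _ _ h := Subtype.ext (DFunLike.coe_injective h)

lemma isCn (f : LipnAlg n E) : IsCn n f.toC := (Subtype.property f).1

lemma isLip (f : LipnAlg n E) {i : ℕ} (hi : i ≤ n) : IsLip (derivI i f.toC) :=
  (Subtype.property f).2 i hi

/-- `‖f‖ = ∑_{i=0}^n ‖f⁽ⁱ⁾‖_Lip / i!`, where `‖g‖_Lip = ‖g‖_∞ + L(g)`. -/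
def lipnNorm (f : LipnAlg n E) : ℝ :=
  ∑ i ∈ Finset.range (n + 1),
    (supNorm (derivI i f.toC) + lipNumber (derivI i f.toC)) / (i.factorial : ℝ)

/-- `Lip^n([0,1],E)` with its norm; addition is that of the ring structure. -/
instance : NormedAddCommGroup (LipnAlg n E) :=
  AddGroupNorm.toNormedAddCommGroup
    { toFun := lipnNorm
      map_zero' := Finset.sum_eq_zero fun i _ => by
        have h : derivI i (0 : LipnAlg n E).toC = 0 :=
          (derivI_const i (0 : E)).trans (by funext; simp)
        rw [h, supNorm_zero, lipNumber_zero, add_zero, zero_div]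
      add_le' := fun f g => by
        unfold lipnNorm
        rw [← Finset.sum_add_distrib]
        refine Finset.sum_le_sum fun i hi => ?_
        have hi' : i ≤ n := Nat.lt_succ_iff.1 (Finset.mem_range.1 hi)
        have hf := f.isLip hi'
        have hg := g.isLip hi'
        have h : derivI i (f + g).toC = derivI i f.toC + derivI i g.toC :=
          derivI_add (f.isCn.of_le hi') (g.isCn.of_le hi')
        rw [h, ← add_div, add_add_add_comm]
        gcongr
        · exact supNorm_add_le hf.continuous hg.continuous
        · exact lipNumber_add_le hf hg
      neg' := fun f => Finset.sum_congr rfl fun i _ => by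
        have h : derivI i (-f).toC = -derivI i f.toC := derivI_neg i f.toC
        rw [h, supNorm_neg, lipNumber_neg]
      eq_zero_of_map_eq_zero' := fun f hf => by
        have h := (Finset.sum_eq_zero_iff_of_nonneg fun i _ =>
          div_nonneg (add_nonneg (supNorm_nonneg _) (lipNumber_nonneg _))
            (Nat.cast_nonneg _)).1 hf 0 (by simp)
        simp only [Nat.factorial_zero, Nat.cast_one, div_one] at h
        have h0 : supNorm (derivI 0 f.toC) = 0 :=
          ((add_eq_zero_iff_of_nonneg (supNorm_nonneg _) (lipNumber_nonneg _)).1 h).1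
        refine Subtype.ext (ContinuousMap.ext fun x => ?_)
        rw [← derivI_zero_apply]
        exact eq_zero_of_supNorm (f.isLip (Nat.zero_le n)).continuous h0 x }

end LipnAlg

end Algebras

/-- `T : A → B`, between spaces of `C(K)`-valued and `C(K')`-valued functions on `[0,1]`, has the
form `T(f)(y)(s) = f(ψ_s(y))(τ(s))` for `s ∈ 𝒞` and `T(f)(y)(s) = conj (f(ψ_s(y))(τ(s)))` for
`s ∉ 𝒞`, with `τ : K' → K` and all `ψ_s : [0,1] → [0,1]` continuous and `𝒞 ⊆ K'` clopen. -/
def HasCompositionForm {K K' A B : Type*} [TopologicalSpace K] [TopologicalSpace K']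
    [FunLike A I C(K, ℂ)] [FunLike B I C(K', ℂ)] (T : A → B) : Prop :=
  ∃ (τ : C(K', K)) (ψ : K' → C(I, I)) (𝒞 : Set K'), IsClopen 𝒞 ∧
    ∀ (f : A) (y : I) (s : K'),
      (s ∈ 𝒞 → T f y s = f (ψ s y) (τ s)) ∧
      (s ∉ 𝒞 → T f y s = (starRingEnd ℂ) (f (ψ s y) (τ s)))

end

/-! ### Stability of differentiability and Lipschitz conditions under conjugation and inversion -/

section Regularity

/-! Fix y and s. On the complex constants, f ↦ T(f)(y)(s) is a continuous ring endomorphism of ℂ,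
hence the identity or conjugation; T(i)(y)(s) = ±i tells which. As [0,1] is connected, the sign
depends on s alone, and by continuity 𝒞 is clopen. After conjugating if necessary, f ↦ T(f)(y)(s) is
a complex-linear character. Since the algebra is closed under conjugation and inverses, a
compactness argument (`IsFullSubring.exists_eq_eval`) makes it evaluation at some point p(y,s) of
[0,1] × K.

It remains to see that the K-component of p(y,s) does not depend on y. Functions constant in the
[0,1] variable show that its composition with every real h ∈ C(K) is differentiable in y, because
the target consists of C¹ functions. As h is arbitrary, √(h - c)⁺ and √(h - c)⁻ may be used as well,
which forces every derivative to vanish (`eq_of_forall_differentiableOn`). Continuity of τ and ψ_s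
is read off from the images of such functions and of the inclusion of [0,1]. -/

lemma IsLip.star {E : Type*} [NormedCommRing E] [StarRing E] [NormedStarGroup E]
    {g : I → E} (hg : IsLip g) : IsLip (star g) := by
  obtain ⟨a, ha⟩ := hg
  refine ⟨a, LipschitzWith.of_dist_le_mul fun x y => ?_⟩
  rw [Pi.star_apply, Pi.star_apply, dist_eq_norm, ← star_sub, norm_star, ← dist_eq_norm]
  exact ha.dist_le_mul x y

variable {E : Type*} [NormedCommRing E] [NormedAlgebra ℝ E]

lemma derivI_star [StarRing E] [NormedStarGroup E] [StarModule ℝ E] (i : ℕ) (f : C(I, E)) :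
    derivI i (star f) = star (derivI i f) := by
  funext x
  have h := (starₗᵢ (E := E) ℝ).toContinuousLinearEquiv.iteratedFDerivWithin_comp_left
    (IccExtend zero_le_one f) uniqueDiffOn_Icc_zero_one x.2 i
  exact congrArg (fun m => m fun _ => (1 : ℝ)) h

lemma IsCn.star [StarRing E] [NormedStarGroup E] [StarModule ℝ E] {n : ℕ} {f : C(I, E)}
    (hf : IsCn n f) : IsCn n (star f) :=
  (starₗᵢ (E := E) ℝ).toContinuousLinearEquiv.contDiff.comp_contDiffOn hf

/-- Mean value inequality: the next derivative is continuous on a compact interval, hence bounded.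
Thus only the derivative of top order carries a genuine Lipschitz condition. -/
lemma IsCn.isLip_derivI {n i : ℕ} {f : C(I, E)} (hf : IsCn n f) (hi : i < n) :
    IsLip (derivI i f) := by
  have hd : DifferentiableOn ℝ
      (iteratedDerivWithin i (IccExtend zero_le_one f) (Icc (0 : ℝ) 1)) (Icc (0 : ℝ) 1) :=
    hf.differentiableOn_iteratedDerivWithin (by exact_mod_cast hi) uniqueDiffOn_Icc_zero_one
  have hc : Continuous (derivI (i + 1) f) := continuous_derivI (hf.of_le hi)
  obtain ⟨B, hB⟩ := bddAbove_norm hc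
  have hB' : ∀ x, ‖derivI (i + 1) f x‖ ≤ B := fun x => hB ⟨x, rfl⟩
  have hB0 : 0 ≤ B := (norm_nonneg _).trans (hB' 0)
  refine ⟨⟨B, hB0⟩, LipschitzWith.of_dist_le_mul fun x y => ?_⟩
  rw [dist_eq_norm]
  refine (convex_Icc (0 : ℝ) 1).norm_image_sub_le_of_norm_derivWithin_le hd (fun z hz => ?_) y.2 x.2
  rw [← iteratedDerivWithin_succ]
  exact hB' ⟨z, hz⟩

/-- Inversion is smooth at every unit of a complete normed algebra, so the chain rule applies. -/
lemma IsCn.of_mul_eq_one [CompleteSpace E] {n : ℕ} {f g : C(I, E)} (hf : IsCn n f)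
    (h : f * g = 1) : IsCn n g := by
  have hx : ∀ x, f x * g x = 1 := fun x => DFunLike.congr_fun h x
  have e : IccExtend zero_le_one g = Ring.inverse ∘ IccExtend zero_le_one f := by
    funext x
    exact (Ring.inverse_unit (Units.mkOfMulEqOne _ _ (hx (projIcc 0 1 zero_le_one x)))).symm
  unfold IsCn
  rw [e]
  intro x hxI
  exact (contDiffAt_ringInverse ℝ
    (Units.mkOfMulEqOne _ _ (hx (projIcc 0 1 zero_le_one x)))).comp_contDiffWithinAt x (hf x hxI)

lemma isLip_derivI_of_mul_eq_one [CompleteSpace E] {n : ℕ} {f g : C(I, E)} (hf : IsCn n f)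
    (hl : ∀ i ≤ n, IsLip (derivI i f)) (h : f * g = 1) : ∀ i ≤ n, IsLip (derivI i g) := by
  have hg := hf.of_mul_eq_one h
  intro i hi
  rcases hi.lt_or_eq with hlt | rfl
  · exact hg.isLip_derivI hlt
  rcases i with _ | i
  · have hx : ∀ x, f x * g x = 1 := fun x => DFunLike.congr_fun h x
    obtain ⟨a, ha⟩ := hl 0 le_rfl
    obtain ⟨B, hB⟩ := bddAbove_norm g.continuous
    have hB' : ∀ x, ‖g x‖ ≤ B := fun x => hB ⟨x, rfl⟩
    have hB0 : 0 ≤ B := (norm_nonneg _).trans (hB' 0)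
    refine ⟨⟨B * a * B, by positivity⟩, LipschitzWith.of_dist_le_mul fun x y => ?_⟩
    have h1 : ‖f y - f x‖ ≤ a * dist x y := by
      simpa [dist_eq_norm, derivI_zero_apply, norm_sub_rev] using ha.dist_le_mul x y
    -- The resolvent-type identity for pointwise inverses.
    have e : g x - g y = g x * (f y - f x) * g y := by
      linear_combination (-g x) * hx y + g y * hx x
    rw [derivI_zero_apply, derivI_zero_apply, dist_eq_norm, e]
    calc _ ≤ ‖g x‖ * ‖f y - f x‖ * ‖g y‖ :=
          (norm_mul_le _ _).trans (mul_le_mul_of_nonneg_right (norm_mul_le _ _) (norm_nonneg _))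
      _ ≤ B * (a * dist x y) * B := by
          gcongr
          · exact hB' x
          · exact hB' y
      _ = (B * a * B) * dist x y := by ring
  · have hlow : ∀ j ≤ i, IsLip (derivI j g) := fun j hj =>
      hg.isLip_derivI (Nat.lt_succ_of_le hj)
    have hz : derivI (i + 1) (f * g) = 0 := by
      rw [h]
      exact (derivI_const (i + 1) (1 : E)).trans (by funext; simp)
    rw [derivI_mul hf hg, Finset.sum_range_succ'] at hz
    -- In the Leibniz formula for (f g)⁽ⁱ⁺¹⁾ = 0 the term f g⁽ⁱ⁺¹⁾ is isolated and multiplied by g =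
    -- f⁻¹; the other terms involve only derivatives of g of order at most i.
    have key : derivI (i + 1) g = -(fun x => derivI 0 g x *
        (∑ j ∈ Finset.range (i + 1), fun x => ((i + 1).choose (j + 1) : E) *
          derivI (j + 1) f x * derivI (i + 1 - (j + 1)) g x) x) := by
      funext x
      have h2 := congrFun hz x
      have hx : f x * g x = 1 := DFunLike.congr_fun h x
      simp only [Pi.add_apply, Pi.zero_apply, Nat.choose_zero_right, Nat.cast_one, one_mul,
        Nat.sub_zero, derivI_zero_apply] at h2
      rw [Pi.neg_apply, derivI_zero_apply]
      linear_combination (-derivI (i + 1) g x) * hx + g x * h2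
    rw [key]
    refine ((hlow 0 (Nat.zero_le _)).mul (IsLip.sum _ fun j hj => ?_)).neg
    have hj' : j < i + 1 := Finset.mem_range.1 hj
    exact ((isLip_const _).mul (hl (j + 1) hj')).mul (hlow _ (by omega))

/-- The inclusion `[0,1] → E`. -/
noncomputable def inclI (E : Type*) [NormedCommRing E] [NormedAlgebra ℝ E] : C(I, E) :=
  ⟨fun x => algebraMap ℝ E x, (algebraMapCLM ℝ E).continuous.comp continuous_subtype_val⟩

lemma isCn_inclI (n : ℕ) : IsCn n (inclI E) := by
  refine ((algebraMapCLM ℝ E).contDiff.contDiffOn).congr fun x hx => ?_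
  rw [IccExtend_of_mem _ _ hx]
  rfl

end Regularity

/-- A subring of `C([0,1],E)` closed under `star` and under inverses, and containing the constants
and the inclusion of `[0,1]`. -/
structure IsFullSubring {E : Type*} [NormedCommRing E] [NormedAlgebra ℝ E] [StarRing E]
    [NormedStarGroup E] (S : Subring C(I, E)) : Prop where
  const_mem : ∀ e, ContinuousMap.const I e ∈ S
  inclI_mem : inclI E ∈ S
  star_mem : ∀ {f}, f ∈ S → star f ∈ S
  inv_mem : ∀ {f g}, f ∈ S → f * g = 1 → g ∈ S

section Full

variable (n : ℕ) (E : Type*) [NormedCommRing E] [NormedAlgebra ℝ E] [StarRing E]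
  [NormedStarGroup E] [StarModule ℝ E] [CompleteSpace E]

lemma isFullSubring_cnSubring : IsFullSubring (cnSubring n E) where
  const_mem := isCn_const n
  inclI_mem := isCn_inclI n
  star_mem h := IsCn.star h
  inv_mem h := IsCn.of_mul_eq_one h

lemma isFullSubring_lipnSubring : IsFullSubring (lipnSubring n E) where
  -- Constants are of class Cⁿ⁺¹, so all derivatives up to order n are Lipschitz.
  const_mem e := ⟨isCn_const n e, fun _ hi =>
    (isCn_const (n + 1) e).isLip_derivI (Nat.lt_succ_of_le hi)⟩
  inclI_mem := ⟨isCn_inclI n, fun _ hi =>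
    (isCn_inclI (n + 1)).isLip_derivI (Nat.lt_succ_of_le hi)⟩
  star_mem h := ⟨h.1.star, fun i hi => by
    rw [derivI_star]
    exact (h.2 i hi).star⟩
  inv_mem h hg := ⟨h.1.of_mul_eq_one hg, isLip_derivI_of_mul_eq_one h.1 h.2 hg⟩

end Full

/-! ### Characters are point evaluations -/

section Characters

variable {K : Type*} [TopologicalSpace K] [CompactSpace K]

lemma exists_mul_eq_one_of_forall_ne_zero {f : C(I, C(K, ℂ))} (hf : ∀ x k, f x k ≠ 0) :
    ∃ g, f * g = 1 := by
  have hu : IsUnit f := by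
    rw [ContinuousMap.isUnit_iff_forall_isUnit]
    intro x
    rw [ContinuousMap.isUnit_iff_forall_ne_zero]
    exact hf x
  exact hu.exists_right_inv

lemma continuous_uncurry_apply (f : C(I, C(K, ℂ))) : Continuous fun p : I × K => f p.1 p.2 :=
  ContinuousEval.continuous_eval.comp ((f.continuous.comp continuous_fst).prodMk continuous_snd)

/-- The embedding of the complex scalars into a full subring of `C([0,1],C(K))`. -/
noncomputable def IsFullSubring.scalar {S : Subring C(I, C(K, ℂ))} (hS : IsFullSubring S) :
    ℂ →+* S where
  toFun c := ⟨ContinuousMap.const I (algebraMap ℂ C(K, ℂ) c), hS.const_mem _⟩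
  map_zero' := Subtype.ext (by ext; simp)
  map_one' := Subtype.ext (by ext; simp)
  map_add' _ _ := Subtype.ext (by ext; simp)
  map_mul' _ _ := Subtype.ext (by ext; simp)

/-- Evaluation at a point, on a subring of `C([0,1],C(K))`. -/
noncomputable def evalHom (S : Subring C(I, C(K, ℂ))) (y : I) (s : K) : S →+* ℂ where
  toFun f := f.1 y s
  map_zero' := rfl
  map_one' := rfl
  map_add' _ _ := rfl
  map_mul' _ _ := rfl

/-- A complex-linear character of a full subring of `C([0,1],C(K))` is a point evaluation. -/
theorem IsFullSubring.exists_eq_eval {S : Subring C(I, C(K, ℂ))} (hS : IsFullSubring S)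
    (χ : S →+* ℂ) (hχ : ∀ c, χ (hS.scalar c) = c) :
    ∃ p : I × K, ∀ f : S, χ f = f.1 p.1 p.2 := by
  by_contra! hcon
  have h1 : ∀ p : I × K, ∃ f : S, χ f = 0 ∧ f.1 p.1 p.2 ≠ 0 := fun p => by
    obtain ⟨f, hf⟩ := hcon p
    -- Subtracting the scalar χ(f) puts f in the kernel of χ without making it vanish at p.
    refine ⟨f - hS.scalar (χ f), ?_, ?_⟩
    · rw [RingHom.map_sub, hχ, sub_self]
    · have e : evalHom S p.1 p.2 (hS.scalar (χ f)) = χ f := rfl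
      change evalHom S p.1 p.2 (f - hS.scalar (χ f)) ≠ 0
      rw [RingHom.map_sub, e]
      exact sub_ne_zero.2 hf.symm
  choose F hF0 hF using h1
  obtain ⟨t, ht⟩ := isCompact_univ.elim_nhds_subcover
    (fun p : I × K => {q : I × K | (F p).1 q.1 q.2 ≠ 0})
    fun p _ => (isOpen_ne_fun (continuous_uncurry_apply _) continuous_const).mem_nhds (hF p)
  -- The sum of the |F p|² lies in the kernel of χ, yet it is positive everywhere because the sets
  -- {F p ≠ 0} cover. It is therefore invertible in S, which is absurd.
  let h : S := ∑ p ∈ t, F p * ⟨star (F p).1, hS.star_mem (F p).2⟩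
  have hχ0 : χ h = 0 :=
    (RingHom.ker χ).sum_mem fun p _ => Ideal.mul_mem_right _ _ (hF0 p)
  have hval : ∀ x k, h.1 x k = ((∑ p ∈ t, Complex.normSq ((F p).1 x k) : ℝ) : ℂ) := by
    intro x k
    have e : h.1 = ∑ p ∈ t, (F p).1 * star (F p).1 :=
      AddSubmonoidClass.coe_finsetSum _ _
    rw [e, ContinuousMap.sum_apply, ContinuousMap.sum_apply, Complex.ofReal_sum]
    exact Finset.sum_congr rfl fun p _ => Complex.mul_conj _
  have hne : ∀ x k, h.1 x k ≠ 0 := by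
    intro x k
    rw [hval, Complex.ofReal_ne_zero]
    obtain ⟨p, hp, hq⟩ := mem_iUnion₂.1 (ht.2 (mem_univ (x, k)))
    have hq' : (F p).1 x k ≠ 0 := hq
    have hpos : 0 < ∑ p ∈ t, Complex.normSq ((F p).1 x k) :=
      Finset.sum_pos' (fun _ _ => Complex.normSq_nonneg _) ⟨p, hp, Complex.normSq_pos.2 hq'⟩
    exact hpos.ne'
  obtain ⟨g, hg⟩ := exists_mul_eq_one_of_forall_ne_zero hne
  have h2 : h * ⟨g, hS.inv_mem h.2 hg⟩ = 1 := Subtype.ext hg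
  have h3 := congrArg χ h2
  rw [RingHom.map_mul, hχ0, zero_mul, RingHom.map_one] at h3
  exact zero_ne_one h3

end Characters

/-! ### Rigidity of curves with differentiable observables -/

section Rigidity

variable {K : Type*} [TopologicalSpace K]

/-- Square roots of the positive and negative parts force the derivative to vanish. -/
lemma hasDerivAt_eq_zero_of_sqrt {g : ℝ → ℝ} {c d : ℝ} (hg : HasDerivAt g d c)
    (hu : DifferentiableAt ℝ (fun x => √(g x - g c)) c)
    (hv : DifferentiableAt ℝ (fun x => √(-(g x - g c))) c) : d = 0 := by
  -- `√` is zero on negative reals, so this is t = t⁺ - t⁻. Both roots vanish at c, so their squares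
  -- have derivative 0 there.
  have e : (fun x => g x - g c) = fun x => √(g x - g c) ^ 2 - √(-(g x - g c)) ^ 2 := by
    funext x
    rcases le_total 0 (g x - g c) with h | h
    · rw [Real.sq_sqrt h, Real.sqrt_eq_zero_of_nonpos (neg_nonpos.2 h)]
      ring
    · rw [Real.sq_sqrt (neg_nonneg.2 h), Real.sqrt_eq_zero_of_nonpos h]
      ring
  have h1 := (hu.hasDerivAt.pow 2).sub (hv.hasDerivAt.pow 2)
  have h2 := hg.sub_const (g c)
  rw [e] at h2
  simpa using h2.unique h1

/-- A map from `[0,1]` to a compact Hausdorff space, all of whose compositions with continuous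
real functions are differentiable, is constant. -/
theorem eq_of_forall_differentiableOn [CompactSpace K] [T2Space K] (φ : I → K)
    (hφ : ∀ h : C(K, ℝ), DifferentiableOn ℝ (IccExtend zero_le_one fun y => h (φ y))
      (Icc (0 : ℝ) 1)) (a b : I) : φ a = φ b := by
  wlog hab : a < b generalizing a b
  · rcases (not_lt.1 hab).lt_or_eq with h | h
    · exact (this b a h).symm
    · rw [h]
  by_contra hne
  -- A Urysohn function separating the two values rises from 0 to 1 along the curve, so its slope is
  -- nonzero at some c.
  obtain ⟨h, h0, h1, -⟩ := exists_continuous_zero_one_of_isClosed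
    (isClosed_singleton (x := φ a)) (isClosed_singleton (x := φ b)) (by simpa using hne)
  have ha0 : h (φ a) = 0 := h0 rfl
  have hb1 : h (φ b) = 1 := h1 rfl
  set g : ℝ → ℝ := IccExtend zero_le_one fun y => h (φ y) with hg
  have hsub : Icc (a : ℝ) b ⊆ Icc 0 1 := Icc_subset_Icc a.2.1 b.2.2
  have hnhds : ∀ c ∈ Ioo (a : ℝ) b, Icc (0 : ℝ) 1 ∈ nhds c := fun c hc =>
    Filter.mem_of_superset (Icc_mem_nhds hc.1 hc.2) hsub
  obtain ⟨c, hc, hs⟩ := exists_deriv_eq_slope g (show (a : ℝ) < b from hab)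
    ((hφ h).continuousOn.mono hsub)
    fun c hc => ((hφ h).differentiableAt (hnhds c hc)).differentiableWithinAt
  have hga : g a = 0 := by rw [hg, IccExtend_val, ha0]
  have hgb : g b = 1 := by rw [hg, IccExtend_val, hb1]
  have hzero : deriv g c = 0 := hasDerivAt_eq_zero_of_sqrt
    ((hφ h).differentiableAt (hnhds c hc)).hasDerivAt
    ((hφ ⟨fun k => √(h k - g c), by fun_prop⟩).differentiableAt (hnhds c hc))
    ((hφ ⟨fun k => √(-(h k - g c)), by fun_prop⟩).differentiableAt (hnhds c hc))
  rw [hzero, hga, hgb, sub_zero] at hs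
  exact (one_div_pos.2 (sub_pos.2 (show (a : ℝ) < b from hab))).ne hs

end Rigidity

/-! ### The composition form -/

section Representation

variable {K K' : Type*} [TopologicalSpace K] [CompactSpace K] [TopologicalSpace K']
  [CompactSpace K']

lemma isClopen_setOf_eq_I {X : Type*} [TopologicalSpace X] {u : X → ℂ} (hu : Continuous u)
    (h : ∀ x, u x = Complex.I ∨ u x = -Complex.I) : IsClopen {x | u x = Complex.I} := by
  refine ⟨isClosed_eq hu continuous_const, ?_⟩
  have e : {x | u x = Complex.I} = {x | u x ≠ -Complex.I} := by
    ext x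
    refine ⟨fun hx hx' => ?_, fun hx => (h x).resolve_right hx⟩
    exact Complex.I_ne_zero (self_eq_neg.1 ((show u x = _ from hx).symm.trans hx'))
  rw [e]
  exact isOpen_ne_fun hu continuous_const

/-- A map into a compact Hausdorff space is continuous as soon as its compositions with continuous
real functions are. -/
lemma continuous_of_forall_comp [T2Space K] {X : Type*} [TopologicalSpace X] {φ : X → K}
    (hφ : ∀ h : C(K, ℝ), Continuous fun x => h (φ x)) : Continuous φ := by
  refine continuous_iff_continuousAt.2 fun x U hU => ?_
  obtain ⟨V, hVU, hV, hxV⟩ := mem_nhds_iff.1 hU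
  obtain ⟨h, h0, h1, -⟩ := exists_continuous_zero_one_of_isClosed
    (isClosed_singleton (x := φ x)) hV.isClosed_compl (by simpa using hxV)
  have hx0 : h (φ x) = 0 := h0 rfl
  have hmem : {z | h (φ z) < 1} ∈ nhds x :=
    (isOpen_lt (hφ h) continuous_const).mem_nhds (by simp [hx0])
  refine Filter.mem_map.2 (Filter.mem_of_superset hmem fun z hz => hVU ?_)
  by_contra hzV
  exact (ne_of_lt hz) (h1 hzV)

/-- The representation of ring homomorphisms from a full subring of `C([0,1],C(K))` to a ring of
continuously differentiable functions. -/
theorem IsFullSubring.exists_compositionForm [T2Space K] {S : Subring C(I, C(K, ℂ))}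
    (hS : IsFullSubring S) {R : Subring C(I, C(K', ℂ))} (hR : ∀ g ∈ R, IsCn 1 g) (T : S →+* R)
    (hT : ∀ y s, Continuous fun c : ℂ => (T (hS.scalar c)).1 y s) :
    ∃ (τ : C(K', K)) (ψ : K' → C(I, I)) (𝒞 : Set K'), IsClopen 𝒞 ∧
      ∀ (f : S) (y : I) (s : K'),
        (s ∈ 𝒞 → (T f).1 y s = f.1 (ψ s y) (τ s)) ∧
        (s ∉ 𝒞 → (T f).1 y s = (starRingEnd ℂ) (f.1 (ψ s y) (τ s))) := by
  have hid : ∀ y s, (∀ c, (T (hS.scalar c)).1 y s = c) ∨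
      (∀ c, (T (hS.scalar c)).1 y s = (starRingEnd ℂ) c) := fun y s =>
    (Complex.ringHom_eq_id_or_conj_of_continuous
      (f := ((evalHom R y s).comp T).comp hS.scalar) (hT y s)).imp
      (fun h c => RingHom.congr_fun h c) (fun h c => RingHom.congr_fun h c)
  set j : C(I, C(K', ℂ)) := (T (hS.scalar Complex.I)).1 with hj_def
  have hj : ∀ y s, j y s = Complex.I ∨ j y s = -Complex.I := fun y s =>
    (hid y s).imp (fun h => h _) (fun h => (h _).trans Complex.conj_I)
  -- The set of y where j takes the value i is clopen in the connected interval.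
  have hji : ∀ y s, j 0 s = Complex.I ↔ j y s = Complex.I := fun y s => by
    have hc : IsClopen {y | j y s = Complex.I} :=
      isClopen_setOf_eq_I ((continuous_eval_const s).comp j.continuous) fun y => hj y s
    rcases isClopen_iff.1 hc with h | h
    · exact iff_of_false (fun h' => (h ▸ h' : (0 : I) ∈ (∅ : Set I)))
        (fun h' => (h ▸ h' : y ∈ (∅ : Set I)))
    · exact iff_of_true (h ▸ mem_univ (0 : I) : (0 : I) ∈ {y | j y s = Complex.I})
        (h ▸ mem_univ y : y ∈ {y | j y s = Complex.I})
  have hI : Complex.I ≠ -Complex.I := fun h => Complex.I_ne_zero (self_eq_neg.1 h)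
  have hp : ∀ y s, ∃ p : I × K, ∀ f : S,
      (j 0 s = Complex.I → (T f).1 y s = f.1 p.1 p.2) ∧
      (j 0 s ≠ Complex.I → (T f).1 y s = (starRingEnd ℂ) (f.1 p.1 p.2)) := by
    intro y s
    rcases hid y s with h | h
    · obtain ⟨p, hp⟩ := hS.exists_eq_eval ((evalHom R y s).comp T) h
      exact ⟨p, fun f => ⟨fun _ => hp f, fun h' => absurd ((hji y s).2 (h _)) h'⟩⟩
    · obtain ⟨p, hp⟩ := hS.exists_eq_eval ((starRingEnd ℂ).comp ((evalHom R y s).comp T))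
        fun c => (congrArg _ (h c)).trans (Complex.conj_conj c)
      refine ⟨p, fun f => ⟨fun h' => ?_, fun _ => ?_⟩⟩
      · exact absurd (((hji y s).1 h').symm.trans ((h _).trans Complex.conj_I)) hI
      · rw [← hp f]
        exact (Complex.conj_conj _).symm
  choose p hp using hp
  -- Real parts ignore conjugation, so both cases are handled at once wherever f is real at p(y,s).
  have hreal : ∀ (f : S) (y : I) (s : K') (r : ℝ), f.1 (p y s).1 (p y s).2 = r →
      ((T f).1 y s).re = r := by
    intro f y s r hr
    by_cases h : j 0 s = Complex.I
    · rw [(hp y s f).1 h, hr, Complex.ofReal_re]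
    · rw [(hp y s f).2 h, hr, Complex.conj_ofReal, Complex.ofReal_re]
  let F : C(K, ℝ) → S := fun h =>
    ⟨ContinuousMap.const I ⟨fun k => (h k : ℂ), by fun_prop⟩, hS.const_mem _⟩
  have hF : ∀ h y s, ((T (F h)).1 y s).re = h (p y s).2 := fun h y s =>
    hreal (F h) y s _ rfl
  have hconst : ∀ s y, (p y s).2 = (p 0 s).2 := by
    intro s y
    refine eq_of_forall_differentiableOn (fun y => (p y s).2) (fun h => ?_) y 0
    -- Here the C¹ regularity of the target enters.
    have hd : DifferentiableOn ℝ (IccExtend zero_le_one (T (F h)).1) (Icc (0 : ℝ) 1) :=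
      ContDiffOn.differentiableOn (hR _ (T (F h)).2) (by simp)
    refine ((Complex.reCLM.comp (ContinuousMap.evalCLM ℝ s)).differentiable.comp_differentiableOn
      hd).congr fun x hx => ?_
    exact (hF h (projIcc 0 1 zero_le_one x) s).symm
  refine ⟨⟨fun s => (p 0 s).2, continuous_of_forall_comp fun h => ?_⟩,
    fun s => ⟨fun y => (p y s).1, ?_⟩, {s | j 0 s = Complex.I},
    isClopen_setOf_eq_I (j 0).continuous (hj 0), fun f y s => ?_⟩
  · simp_rw [← hF]
    exact Complex.continuous_re.comp ((T (F h)).1 0).continuous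
  · have hincl : ∀ y, ((T ⟨inclI C(K, ℂ), hS.inclI_mem⟩).1 y s).re = (p y s).1 := fun y =>
      hreal _ y s _ rfl
    refine continuous_induced_rng.2 ?_
    change Continuous fun y => ((p y s).1 : ℝ)
    simp_rw [← hincl]
    exact Complex.continuous_re.comp ((continuous_eval_const s).comp
      (T ⟨inclI C(K, ℂ), hS.inclI_mem⟩).1.continuous)
  · change (j 0 s = Complex.I → (T f).1 y s = f.1 (p y s).1 (p 0 s).2) ∧
      (j 0 s ≠ Complex.I → (T f).1 y s = (starRingEnd ℂ) (f.1 (p y s).1 (p 0 s).2))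
    rw [← hconst s y]
    exact hp y s f

end Representation

/-! ### Norms of constants and bounds for point values -/

section Norms

lemma supNorm_const {E : Type*} [NormedCommRing E] (e : E) :
    supNorm (fun _ : I => e) = ‖e‖ := ciSup_const

lemma lipNumber_const {E : Type*} [NormedCommRing E] (e : E) :
    lipNumber (fun _ : I => e) = 0 := by simp [lipNumber]

variable {n : ℕ} {E : Type*} [NormedCommRing E] [NormedAlgebra ℝ E]

lemma norm_le_supNorm_derivI_zero (f : C(I, E)) (x : I) : ‖f x‖ ≤ supNorm (derivI 0 f) := by
  have h : derivI 0 f = f := funext (derivI_zero_apply f)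
  rw [h]
  exact le_ciSup (bddAbove_norm f.continuous) x

lemma CnAlg.norm_apply_le (f : CnAlg n E) (x : I) : ‖f x‖ ≤ ‖f‖ := by
  refine (norm_le_supNorm_derivI_zero f.toC x).trans ?_
  have h := Finset.single_le_sum (f := fun i => supNorm (derivI i f.toC) / (i.factorial : ℝ))
    (fun i _ => div_nonneg (supNorm_nonneg _) (Nat.cast_nonneg _))
    (Finset.mem_range.2 (Nat.succ_pos n))
  rwa [Nat.factorial_zero, Nat.cast_one, div_one] at h

lemma LipnAlg.norm_apply_le (f : LipnAlg n E) (x : I) : ‖f x‖ ≤ ‖f‖ := by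
  refine (norm_le_supNorm_derivI_zero f.toC x).trans ?_
  have h := Finset.single_le_sum
    (f := fun i => (supNorm (derivI i f.toC) + lipNumber (derivI i f.toC)) / (i.factorial : ℝ))
    (fun i _ => div_nonneg (add_nonneg (supNorm_nonneg _) (lipNumber_nonneg _))
      (Nat.cast_nonneg _)) (Finset.mem_range.2 (Nat.succ_pos n))
  rw [Nat.factorial_zero, Nat.cast_one, div_one] at h
  exact (le_add_of_nonneg_right (lipNumber_nonneg _)).trans h

/-- All terms of positive order vanish. -/
lemma CnAlg.norm_of_toC_eq_const {f : CnAlg n E} {e : E} (h : f.toC = ContinuousMap.const I e) :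
    ‖f‖ = ‖e‖ := by
  change ∑ i ∈ Finset.range (n + 1), supNorm (derivI i f.toC) / (i.factorial : ℝ) = _
  simp_rw [h, derivI_const, supNorm_const]
  rw [Finset.sum_eq_single 0 (fun i _ hi => by simp [hi]) (by simp)]
  simp

lemma LipnAlg.norm_of_toC_eq_const {f : LipnAlg n E} {e : E}
    (h : f.toC = ContinuousMap.const I e) : ‖f‖ = ‖e‖ := by
  change ∑ i ∈ Finset.range (n + 1),
    (supNorm (derivI i f.toC) + lipNumber (derivI i f.toC)) / (i.factorial : ℝ) = _
  simp_rw [h, derivI_const, supNorm_const, lipNumber_const]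
  rw [Finset.sum_eq_single 0 (fun i _ hi => by simp [hi]) (by simp)]
  simp

end Norms

/-! ### Continuity of scalars and of point evaluations -/

section Continuity

variable {K : Type*} [TopologicalSpace K] [CompactSpace K]

lemma continuous_of_norm_le {A : Type*} [NormedAddCommGroup A] (k : ℂ → A)
    (hsub : ∀ a b, k (a - b) = k a - k b) (hk : ∀ c, ‖k c‖ ≤ ‖algebraMap ℂ C(K, ℂ) c‖) :
    Continuous k := by
  refine (LipschitzWith.of_dist_le_mul (K := 1) fun a b => ?_).continuous
  rw [dist_eq_norm, dist_eq_norm, ← hsub, NNReal.coe_one, one_mul]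
  refine (hk _).trans ?_
  -- Only an inequality holds in general: for empty K the norm on the left is 0.
  rw [ContinuousMap.norm_le _ (norm_nonneg _)]
  intro x
  exact le_refl ‖a - b‖

/-- The complex scalars in `CnAlg n C(K, ℂ)`. -/
noncomputable def CnAlg.scalar (n : ℕ) (K : Type*) [TopologicalSpace K] [CompactSpace K] :
    ℂ →+* CnAlg n C(K, ℂ) :=
  (isFullSubring_cnSubring n C(K, ℂ)).scalar

lemma CnAlg.continuous_scalar (n : ℕ) : Continuous (CnAlg.scalar n K) :=
  continuous_of_norm_le (K := K) _ (fun a b => RingHom.map_sub _ a b)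
    fun _ => (CnAlg.norm_of_toC_eq_const rfl).le

/-- The complex scalars in `LipnAlg n C(K, ℂ)`. -/
noncomputable def LipnAlg.scalar (n : ℕ) (K : Type*) [TopologicalSpace K] [CompactSpace K] :
    ℂ →+* LipnAlg n C(K, ℂ) :=
  (isFullSubring_lipnSubring n C(K, ℂ)).scalar

lemma LipnAlg.continuous_scalar (n : ℕ) : Continuous (LipnAlg.scalar n K) :=
  continuous_of_norm_le (K := K) _ (fun a b => RingHom.map_sub _ a b)
    fun _ => (LipnAlg.norm_of_toC_eq_const rfl).le

lemma CnAlg.continuous_eval (n : ℕ) (y : I) (s : K) :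
    Continuous fun f : CnAlg n C(K, ℂ) => f y s := by
  refine (LipschitzWith.of_dist_le_mul (K := 1) fun f g => ?_).continuous
  rw [dist_eq_norm, dist_eq_norm, NNReal.coe_one, one_mul]
  exact (ContinuousMap.norm_coe_le_norm ((f - g) y) s).trans (CnAlg.norm_apply_le (f - g) y)

lemma LipnAlg.continuous_eval (n : ℕ) (y : I) (s : K) :
    Continuous fun f : LipnAlg n C(K, ℂ) => f y s := by
  refine (LipschitzWith.of_dist_le_mul (K := 1) fun f g => ?_).continuous
  rw [dist_eq_norm, dist_eq_norm, NNReal.coe_one, one_mul]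
  exact (ContinuousMap.norm_coe_le_norm ((f - g) y) s).trans (LipnAlg.norm_apply_le (f - g) y)

end Continuity

theorem mainTheorem6 (n : ℕ) (hn : 1 ≤ n)
    {K K' : Type*} [TopologicalSpace K] [CompactSpace K] [T2Space K]
    [TopologicalSpace K'] [CompactSpace K'] [T2Space K'] :
    (∀ T : CnAlg n C(K, ℂ) →+* CnAlg n C(K', ℂ), Continuous T → HasCompositionForm T) ∧
    (∀ T : CnAlg n C(K, ℂ) →+* LipnAlg n C(K', ℂ), Continuous T → HasCompositionForm T) ∧
    (∀ T : LipnAlg n C(K, ℂ) →+* CnAlg n C(K', ℂ), Continuous T → HasCompositionForm T) ∧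
    (∀ T : LipnAlg n C(K, ℂ) →+* LipnAlg n C(K', ℂ), Continuous T → HasCompositionForm T) := by
  -- Both algebras unfold to subrings of C([0,1],E), so T serves directly as a homomorphism of
  -- subrings. The norms matter only for the continuity of T along the scalars, and n ≥ 1 supplies
  -- the C¹ target.
  refine ⟨fun T hT => ?_, fun T hT => ?_, fun T hT => ?_, fun T hT => ?_⟩
  · exact (isFullSubring_cnSubring n C(K, ℂ)).exists_compositionForm (R := cnSubring n C(K', ℂ))
      (fun g hg => IsCn.of_le hg hn) T fun y s =>
        (CnAlg.continuous_eval n y s).comp (hT.comp (CnAlg.continuous_scalar n))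
  · exact (isFullSubring_cnSubring n C(K, ℂ)).exists_compositionForm (R := lipnSubring n C(K', ℂ))
      (fun g hg => IsCn.of_le hg.1 hn) T fun y s =>
        (LipnAlg.continuous_eval n y s).comp (hT.comp (CnAlg.continuous_scalar n))
  · exact (isFullSubring_lipnSubring n C(K, ℂ)).exists_compositionForm (R := cnSubring n C(K', ℂ))
      (fun g hg => IsCn.of_le hg hn) T fun y s =>
        (CnAlg.continuous_eval n y s).comp (hT.comp (LipnAlg.continuous_scalar n))
  · exact (isFullSubring_lipnSubring n C(K, ℂ)).exists_compositionForm
      (R := lipnSubring n C(K', ℂ)) (fun g hg => IsCn.of_le hg.1 hn) T fun y s =>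
        (LipnAlg.continuous_eval n y s).comp (hT.comp (LipnAlg.continuous_scalar n))
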